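/- **Theorem.** Let $\mathrm{Poly}^+(\mathbb R^2)$ be the group, under composition, of all orientation-preserving polynomial homeomorphisms of the plane, that is, of all homeomorphisms $h:\mathbb R^2\to\mathbb R^2$ such that the coordinates of both $h$ and $h^{-1}$ are polynomials with real coefficients in the two coordinates of the point, and such that $h$ preserves orientation (the Jacobian determinant of $h$ is positive at every point; note that such an $h$ is a diffeomorphism). Then $\mathrm{Poly}^+(\mathbb R^2)$ is circularly-orderable: there is a circular order on the set $\mathrm{Poly}^+(\mathbb R^2)$ which is invariant under left multiplication by every element of the group. Here a circular order on a set $S$ is a ternary relation on triples of distinct elements of $S$ ("$(x,y,z)$ is positively ordered") such that: if $(x,y,z)$ is positively ordered then so is $(y,z,x)$; for distinct $x,y,z$ exactly one of $(x,y,z)$ and $(z,y,x)$ is positively ordered; and if $(x,y,z)$ and $(y,w,z)$ are positively ordered then so is $(x,w,z)$. Equivalently, it is a choice, for each $p\in S$, of a total order on $S\setminus\{p\}$ ($x<_p y$ iff $(p,x,y)$ is positively ordered), any two of which differ by a cut. -/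

import Mathlib

/-- A group is circularly-orderable if it carries a circular order (as a set) that is invariant
under the action of the group on itself by left multiplication. -/
def CircularlyOrderable (G : Type*) [Group G] : Prop :=
  ∃ c : CircularOrder G, ∀ g x y z : G, c.btw x y z → c.btw (g * x) (g * y) (g * z)

/-- A map of the plane is polynomial if both of its coordinates are real polynomials in the two
coordinates of the point. -/
def IsPolynomialMap (f : (Fin 2 → ℝ) → (Fin 2 → ℝ)) : Prop :=
  ∃ P : Fin 2 → MvPolynomial (Fin 2) ℝ, ∀ x i, f x i = MvPolynomial.eval x (P i)

/-- A differentiable self-homeomorphism of the plane preserves orientation if its differential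
at every point does, that is, if its Jacobian determinant is positive everywhere. -/
def PreservesOrientation (f : (Fin 2 → ℝ) → (Fin 2 → ℝ)) : Prop :=
  Differentiable ℝ f ∧ ∀ x, 0 < (fderiv ℝ f x).det

theorem IsPolynomialMap.id : IsPolynomialMap id :=
  ⟨fun i => MvPolynomial.X i, fun x i => by simp⟩

theorem IsPolynomialMap.comp {f g : (Fin 2 → ℝ) → (Fin 2 → ℝ)}
    (hf : IsPolynomialMap f) (hg : IsPolynomialMap g) : IsPolynomialMap (f ∘ g) := by
  obtain ⟨P, hP⟩ := hf
  obtain ⟨Q, hQ⟩ := hg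
  refine ⟨fun i => MvPolynomial.bind₁ Q (P i), fun x i => ?_⟩
  have hx : g x = fun j => MvPolynomial.eval x (Q j) := funext (hQ x)
  rw [Function.comp_apply, hP, hx]
  exact (MvPolynomial.eval₂Hom_bind₁ (RingHom.id ℝ) x Q (P i)).symm

theorem IsPolynomialMap.differentiable {f : (Fin 2 → ℝ) → (Fin 2 → ℝ)}
    (hf : IsPolynomialMap f) : Differentiable ℝ f := by
  obtain ⟨P, hP⟩ := hf
  rw [differentiable_pi]
  intro i
  have key : ∀ p : MvPolynomial (Fin 2) ℝ,
      Differentiable ℝ (fun x : Fin 2 → ℝ => MvPolynomial.eval x p) := by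
    intro p
    induction p using MvPolynomial.induction_on with
    | C a => simp
    | add p q hp hq =>
      simp only [map_add]
      exact hp.add hq
    | mul_X p j hp =>
      simp only [map_mul, MvPolynomial.eval_X]
      exact hp.mul (differentiable_apply j)
  simpa only [hP] using key (P i)

theorem PreservesOrientation.id : PreservesOrientation id :=
  ⟨differentiable_id, fun x => by
    rw [fderiv_id, ContinuousLinearMap.det, ContinuousLinearMap.coe_id, LinearMap.det_id]
    exact one_pos⟩

theorem PreservesOrientation.comp {f g : (Fin 2 → ℝ) → (Fin 2 → ℝ)}
    (hf : PreservesOrientation f) (hg : PreservesOrientation g) :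
    PreservesOrientation (f ∘ g) := by
  refine ⟨hf.1.comp hg.1, fun x => ?_⟩
  rw [fderiv_comp x (hf.1 (g x)) (hg.1 x), ContinuousLinearMap.det,
    ContinuousLinearMap.toLinearMap_comp, LinearMap.det_comp]
  exact mul_pos (hf.2 (g x)) (hg.2 x)

theorem PreservesOrientation.of_comp_eq_id {f g : (Fin 2 → ℝ) → (Fin 2 → ℝ)}
    (hf : PreservesOrientation f) (hg : Differentiable ℝ g) (h : f ∘ g = _root_.id) :
    PreservesOrientation g := by
  refine ⟨hg, fun x => ?_⟩
  have h1 : 0 < (fderiv ℝ (f ∘ g) x).det := by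
    rw [h]
    exact PreservesOrientation.id.2 x
  rw [fderiv_comp x (hf.1 (g x)) (hg x), ContinuousLinearMap.det,
    ContinuousLinearMap.toLinearMap_comp, LinearMap.det_comp] at h1
  exact (pos_iff_pos_of_mul_pos h1).1 (hf.2 (g x))

/-- The group, under composition, of orientation-preserving polynomial homeomorphisms of the
plane. Being a group, it consists of the homeomorphisms for which both the map and its inverse
are polynomial. -/
def PolyPlus : Subgroup ((Fin 2 → ℝ) ≃ₜ (Fin 2 → ℝ)) where
  carrier := {h | IsPolynomialMap h ∧ IsPolynomialMap h.symm ∧ PreservesOrientation h}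
  one_mem' := ⟨IsPolynomialMap.id, IsPolynomialMap.id, PreservesOrientation.id⟩
  mul_mem' := fun ha hb =>
    ⟨ha.1.comp hb.1, hb.2.1.comp ha.2.1, ha.2.2.comp hb.2.2⟩
  inv_mem' := fun {a} ha =>
    ⟨ha.2.1, ha.1, ha.2.2.of_comp_eq_id ha.2.1.differentiable (funext a.apply_symm_apply)⟩

/-! Pairwise eventually disjoint rays going to infinity in the plane are circularly ordered by where
they cross large circles, and an orientation-preserving diffeomorphism respects this order
(`eventually_orient_pos_of_homeomorph`). So fix a line, let each group element act on its half going
to +∞, and compare the images. Polynomiality makes the comparison work. The squared norm along an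
image curve is a polynomial tending to infinity, hence eventually increasing, so the ray crosses
each large circle at one large parameter (`exists_isRadialInverse`). Two image rays of the same line
either trace the same curve or are eventually disjoint (`IsPolynomialMap.eventually_line_ne`). One
line may fail to separate `a` from `b`, namely when `a⁻¹ * b` preserves it. A polynomial map
preserving many lines is the identity (`IsPolynomialMap.eq_id_of_frequently`), so distinct elements
are separated by almost every line. The orders coming from the single lines are merged by majority
vote along an ultrafilter. -/

open Filter Topology Polynomial

/-! ### Oriented triples of points on a circle -/

/-- The square of the Euclidean norm. -/
def normSq₂ (v : Fin 2 → ℝ) : ℝ := v 0 ^ 2 + v 1 ^ 2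

/-- Twice the signed area of the triangle `a b c`. -/
def orient (a b c : Fin 2 → ℝ) : ℝ :=
  (b 0 - a 0) * (c 1 - a 1) - (b 1 - a 1) * (c 0 - a 0)

theorem orient_cyclic (a b c : Fin 2 → ℝ) : orient b c a = orient a b c := by
  unfold orient; ring

theorem orient_swap (a b c : Fin 2 → ℝ) : orient c b a = -orient a b c := by
  unfold orient; ring

theorem orient_swap_right (a b c : Fin 2 → ℝ) : orient a c b = -orient a b c := by
  unfold orient; ring

/-- Stereographic projection from `p`: a point `a` of the circle has coordinate (p × a) / (r - p ·
a), with positive denominator by `sub_inner_pos`, and the orientation of `p a b` compares the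
coordinates of `a` and `b`. -/
theorem mul_orient_eq {p a b : Fin 2 → ℝ} {r : ℝ} (hp : normSq₂ p = r) :
    r * orient p a b =
      (p 0 * a 1 - p 1 * a 0) * (r - (p 0 * b 0 + p 1 * b 1)) -
        (p 0 * b 1 - p 1 * b 0) * (r - (p 0 * a 0 + p 1 * a 1)) := by
  subst hp; unfold orient normSq₂; ring

theorem sub_inner_pos {p a : Fin 2 → ℝ} {r : ℝ} (hp : normSq₂ p = r) (ha : normSq₂ a = r)
    (h : a ≠ p) : 0 < r - (p 0 * a 0 + p 1 * a 1) := by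
  unfold normSq₂ at hp ha
  have h2 : 0 < (a 0 - p 0) ^ 2 + (a 1 - p 1) ^ 2 := by
    by_contra hn
    have h0 : a 0 - p 0 = 0 := by nlinarith [sq_nonneg (a 0 - p 0), sq_nonneg (a 1 - p 1)]
    have h1 : a 1 - p 1 = 0 := by nlinarith [sq_nonneg (a 0 - p 0), sq_nonneg (a 1 - p 1)]
    apply h
    ext i
    fin_cases i
    · simpa using sub_eq_zero.1 h0
    · simpa using sub_eq_zero.1 h1
  nlinarith

theorem orient_self_left (a c : Fin 2 → ℝ) : orient a a c = 0 := by unfold orient; ring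

theorem orient_self_right (a b : Fin 2 → ℝ) : orient a b b = 0 := by unfold orient; ring

theorem orient_self_outer (a b : Fin 2 → ℝ) : orient a b a = 0 := by unfold orient; ring

theorem orient_trans {a b c d : Fin 2 → ℝ} {r : ℝ} (ha : normSq₂ a = r) (hb : normSq₂ b = r)
    (hc : normSq₂ c = r) (hd : normSq₂ d = r) (h₁ : 0 < orient a b c) (h₂ : 0 < orient b d c) :
    0 < orient a d c := by
  have hac : a ≠ c := by rintro rfl; rw [orient_self_outer] at h₁; exact h₁.false
  have hbc : b ≠ c := by rintro rfl; rw [orient_self_right] at h₁; exact h₁.false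
  have hdc : d ≠ c := by rintro rfl; rw [orient_self_right] at h₂; exact h₂.false
  have pa := sub_inner_pos hc ha hac
  have pb := sub_inner_pos hc hb hbc
  have pd := sub_inner_pos hc hd hdc
  have hr : 0 < r := by
    have h0 : 0 ≤ r := by rw [← hc]; unfold normSq₂; positivity
    refine h0.lt_of_ne fun h => ?_
    subst h
    unfold normSq₂ at ha hc
    have : c 0 = 0 := by nlinarith [sq_nonneg (c 0), sq_nonneg (c 1)]
    have : c 1 = 0 := by nlinarith [sq_nonneg (c 0), sq_nonneg (c 1)]
    simp_all
  -- With `c` as centre of projection, the claim is transitivity of the order of the coordinates of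
  -- `a`, `b`, `d`, with denominators cleared.
  rw [← orient_cyclic, ← orient_cyclic] at h₁ h₂ ⊢
  have e₁ := mul_orient_eq (a := a) (b := b) hc
  have e₂ := mul_orient_eq (a := b) (b := d) hc
  have e₃ := mul_orient_eq (a := a) (b := d) hc
  have q₁ := mul_pos hr h₁
  have q₂ := mul_pos hr h₂
  rw [e₁] at q₁
  rw [e₂] at q₂
  refine pos_of_mul_pos_right (a := r) ?_ hr.le
  rw [e₃]
  set A := c 0 * a 1 - c 1 * a 0
  set B := c 0 * b 1 - c 1 * b 0
  set E := c 0 * d 1 - c 1 * d 0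
  have := mul_pos q₁ pd
  have := mul_pos q₂ pa
  refine pos_of_mul_pos_left (b := r - (c 0 * b 0 + c 1 * b 1)) ?_ pb.le
  nlinarith

/-- A line meets a circle in at most two points. -/
theorem orient_ne_zero {a b c : Fin 2 → ℝ} {r : ℝ} (ha : normSq₂ a = r) (hb : normSq₂ b = r)
    (hc : normSq₂ c = r) (hab : a ≠ b) (hbc : b ≠ c) (hac : a ≠ c) : orient a b c ≠ 0 := by
  intro h
  have e := mul_orient_eq (a := b) (b := c) ha
  have pb := sub_inner_pos ha hb hab.symm
  have pc := sub_inner_pos ha hc hac.symm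
  have pbc := sub_inner_pos hb hc hbc.symm
  rw [h, mul_zero] at e
  have e' : (b 0 - a 0) * (c 1 - a 1) = (b 1 - a 1) * (c 0 - a 0) := by
    unfold orient at h; linarith
  -- the chords from `a` are proportional, hence equal
  unfold normSq₂ at ha hb hc
  have hb' : (b 0 - a 0) ^ 2 + (b 1 - a 1) ^ 2 =
      -2 * (a 0 * (b 0 - a 0) + a 1 * (b 1 - a 1)) := by linarith
  have hc' : (c 0 - a 0) ^ 2 + (c 1 - a 1) ^ 2 =
      -2 * (a 0 * (c 0 - a 0) + a 1 * (c 1 - a 1)) := by linarith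
  have hbpos : 0 < (b 0 - a 0) ^ 2 + (b 1 - a 1) ^ 2 := by nlinarith
  have hcpos : 0 < (c 0 - a 0) ^ 2 + (c 1 - a 1) ^ 2 := by nlinarith
  set x := b 0 - a 0 with hx
  set y := b 1 - a 1 with hy
  set u := c 0 - a 0 with hu
  set v := c 1 - a 1 with hv
  have key : x * u + y * v = u ^ 2 + v ^ 2 := by
    have h1 : (x ^ 2 + y ^ 2) * (x * u + y * v) = (x ^ 2 + y ^ 2) * (u ^ 2 + v ^ 2) := by
      have i1 : (x * u + y * v) * (a 0 * x + a 1 * y) = (x ^ 2 + y ^ 2) * (a 0 * u + a 1 * v) := by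
        linear_combination (a 0 * y - a 1 * x) * e'
      linear_combination (x * u + y * v) * hb' - (x ^ 2 + y ^ 2) * hc' - 2 * i1
    exact mul_left_cancel₀ hbpos.ne' h1
  have key2 : x * u + y * v = x ^ 2 + y ^ 2 := by
    have h1 : (u ^ 2 + v ^ 2) * (x * u + y * v) = (u ^ 2 + v ^ 2) * (x ^ 2 + y ^ 2) := by
      have i1 : (x * u + y * v) * (a 0 * u + a 1 * v) = (u ^ 2 + v ^ 2) * (a 0 * x + a 1 * y) := by
        linear_combination (a 1 * u - a 0 * v) * e'
      linear_combination (x * u + y * v) * hc' - (u ^ 2 + v ^ 2) * hb' - 2 * i1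
    exact mul_left_cancel₀ hcpos.ne' h1
  have hz : (x - u) ^ 2 + (y - v) ^ 2 = 0 := by linarith
  have h0 : x - u = 0 := by nlinarith [sq_nonneg (x - u), sq_nonneg (y - v)]
  have h1 : y - v = 0 := by nlinarith [sq_nonneg (x - u), sq_nonneg (y - v)]
  apply hbc
  ext i
  fin_cases i
  · change b 0 = c 0; linarith
  · change b 1 = c 1; linarith

/-- Rotation of the vector `a` by the angle `s`. -/
noncomputable def rotate₂ (a : Fin 2 → ℝ) (s : ℝ) : Fin 2 → ℝ :=
  ![a 0 * Real.cos s - a 1 * Real.sin s, a 0 * Real.sin s + a 1 * Real.cos s]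

theorem rotate₂_zero (a : Fin 2 → ℝ) : rotate₂ a 0 = a := by
  ext i; fin_cases i <;> simp [rotate₂]

theorem normSq₂_rotate₂ (a : Fin 2 → ℝ) (s : ℝ) : normSq₂ (rotate₂ a s) = normSq₂ a := by
  simp only [normSq₂, rotate₂, Matrix.cons_val_zero, Matrix.cons_val_one]
  linear_combination (a 0 ^ 2 + a 1 ^ 2) * Real.sin_sq_add_cos_sq s

theorem hasDerivAt_rotate₂ (a : Fin 2 → ℝ) : HasDerivAt (rotate₂ a) ![-a 1, a 0] 0 := by
  rw [hasDerivAt_pi]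
  intro i
  fin_cases i
  · simpa [rotate₂] using ((Real.hasDerivAt_cos 0).const_mul (a 0)).fun_sub
      ((Real.hasDerivAt_sin 0).const_mul (a 1))
  · simpa [rotate₂] using ((Real.hasDerivAt_sin 0).const_mul (a 0)).fun_add
      ((Real.hasDerivAt_cos 0).const_mul (a 1))

theorem continuous_rotate₂ (a : Fin 2 → ℝ) : Continuous (rotate₂ a) := by
  refine continuous_pi fun i => ?_
  fin_cases i
  · change Continuous fun s => a 0 * Real.cos s - a 1 * Real.sin s
    fun_prop
  · change Continuous fun s => a 0 * Real.sin s + a 1 * Real.cos s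
    fun_prop

/-- Area of an inscribed triangle as a product of sines of inscribed angles; its sign turns
orientation into the order of the rotation angles. -/
theorem orient_rotate₂ (a : Fin 2 → ℝ) (s t : ℝ) :
    orient a (rotate₂ a s) (rotate₂ a t) =
      4 * normSq₂ a * (Real.sin (s / 2) * Real.sin ((t - s) / 2) * Real.sin (t / 2)) := by
  obtain ⟨x, rfl⟩ : ∃ x, s = 2 * x := ⟨s / 2, by ring⟩
  obtain ⟨y, rfl⟩ : ∃ y, t = 2 * y := ⟨t / 2, by ring⟩
  rw [show 2 * x / 2 = x by ring, show (2 * y - 2 * x) / 2 = y - x by ring,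
    show 2 * y / 2 = y by ring, Real.sin_sub]
  simp only [orient, normSq₂, rotate₂, Matrix.cons_val_zero, Matrix.cons_val_one,
    Real.sin_two_mul, Real.cos_two_mul']
  have hx := Real.sin_sq_add_cos_sq x
  have hy := Real.sin_sq_add_cos_sq y
  rw [Real.cos_sq' x, Real.cos_sq' y]
  have hx' : Real.cos x ^ 2 = 1 - Real.sin x ^ 2 := Real.cos_sq' x
  have hy' : Real.cos y ^ 2 = 1 - Real.sin y ^ 2 := Real.cos_sq' y
  ring_nf

theorem exists_rotate₂_eq {a b : Fin 2 → ℝ} {r : ℝ} (hr : 0 < r) (ha : normSq₂ a = r)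
    (hb : normSq₂ b = r) : ∃ s, 0 ≤ s ∧ s < 2 * Real.pi ∧ rotate₂ a s = b := by
  obtain ⟨s, h0, h1, hc, hs⟩ : ∃ s, 0 ≤ s ∧ s < 2 * Real.pi ∧
      Real.cos s = (a 0 * b 0 + a 1 * b 1) / r ∧ Real.sin s = (a 0 * b 1 - a 1 * b 0) / r := by
    set u := (a 0 * b 0 + a 1 * b 1) / r with hu
    set v := (a 0 * b 1 - a 1 * b 0) / r with hv
    have huv : u ^ 2 + v ^ 2 = 1 := by
      rw [hu, hv]
      field_simp
      unfold normSq₂ at ha hb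
      rw [sq r]
      nth_rewrite 1 [← ha]
      rw [← hb]
      ring
    have hu1 : -1 ≤ u := by nlinarith [sq_nonneg v]
    have hu2 : u ≤ 1 := by nlinarith [sq_nonneg v]
    have hsq : √(1 - u ^ 2) = |v| := by
      rw [show 1 - u ^ 2 = v ^ 2 by linarith, Real.sqrt_sq_eq_abs]
    rcases le_or_gt 0 v with h | h
    · refine ⟨Real.arccos u, Real.arccos_nonneg u, ?_, Real.cos_arccos hu1 hu2, ?_⟩
      · linarith [Real.arccos_le_pi u, Real.pi_pos]
      · rw [Real.sin_arccos, hsq, abs_of_nonneg h]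
    · refine ⟨2 * Real.pi - Real.arccos u, ?_, ?_, ?_, ?_⟩
      · linarith [Real.arccos_le_pi u, Real.pi_pos]
      · have : 0 < Real.arccos u := Real.arccos_pos.2 (by nlinarith)
        linarith
      · rw [Real.cos_two_pi_sub, Real.cos_arccos hu1 hu2]
      · rw [Real.sin_two_pi_sub, Real.sin_arccos, hsq, abs_of_neg h, neg_neg]
  refine ⟨s, h0, h1, ?_⟩
  unfold normSq₂ at ha
  ext i
  fin_cases i
  · change a 0 * Real.cos s - a 1 * Real.sin s = b 0
    rw [hc, hs]
    field_simp
    linear_combination b 0 * ha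
  · change a 0 * Real.sin s + a 1 * Real.cos s = b 1
    rw [hc, hs]
    field_simp
    linear_combination b 1 * ha

theorem rotate₂_ne_self {a : Fin 2 → ℝ} {s : ℝ} (ha : 0 < normSq₂ a) (h0 : 0 < s)
    (h1 : s < 2 * Real.pi) : rotate₂ a s ≠ a := by
  intro h
  have hc : normSq₂ a * Real.cos s = normSq₂ a * 1 := by
    have e0 : a 0 * Real.cos s - a 1 * Real.sin s = a 0 := congrFun h 0
    have e1 : a 0 * Real.sin s + a 1 * Real.cos s = a 1 := congrFun h 1
    unfold normSq₂
    linear_combination a 0 * e0 + a 1 * e1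
  have := (Real.cos_eq_one_iff_of_lt_of_lt (by linarith) h1).1 (mul_left_cancel₀ ha.ne' hc)
  exact h0.ne' this

theorem rotate₂_ne_rotate₂ {a : Fin 2 → ℝ} {s t : ℝ} (ha : 0 < normSq₂ a) (hs : 0 ≤ s) (hst : s < t)
    (ht : t < 2 * Real.pi) : rotate₂ a s ≠ rotate₂ a t := by
  intro h
  apply rotate₂_ne_self (a := rotate₂ a s) (s := t - s) (by rwa [normSq₂_rotate₂])
    (by linarith) (by linarith)
  rw [h]
  nth_rewrite 1 [← h]
  rw [show t = s + (t - s) by ring]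
  ext i
  fin_cases i <;>
  simp only [rotate₂, Matrix.cons_val_zero, Matrix.cons_val_one, Real.cos_add, Real.sin_add] <;>
  simp <;> ring

theorem lt_of_orient_rotate₂_pos {a : Fin 2 → ℝ} {s t : ℝ} (hs : 0 ≤ s)
    (hs' : s < 2 * Real.pi) (ht : 0 ≤ t) (ht' : t < 2 * Real.pi)
    (h : 0 < orient a (rotate₂ a s) (rotate₂ a t)) : 0 < s ∧ s < t := by
  rw [orient_rotate₂] at h
  have ha : 0 ≤ normSq₂ a := by unfold normSq₂; positivity
  have h1 : 0 ≤ Real.sin (s / 2) := Real.sin_nonneg_of_nonneg_of_le_pi (by linarith) (by linarith)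
  have h2 : 0 ≤ Real.sin (t / 2) := Real.sin_nonneg_of_nonneg_of_le_pi (by linarith) (by linarith)
  refine ⟨hs.lt_of_ne ?_, ?_⟩
  · rintro rfl
    simp at h
  · by_contra hst
    have h3 : Real.sin ((t - s) / 2) ≤ 0 :=
      Real.sin_nonpos_of_nonpos_of_neg_pi_le (by linarith) (by linarith)
    have h4 : Real.sin (s / 2) * Real.sin ((t - s) / 2) * Real.sin (t / 2) ≤ 0 :=
      mul_nonpos_of_nonpos_of_nonneg (mul_nonpos_of_nonneg_of_nonpos h1 h3) h2
    nlinarith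

/-! ### Rays to infinity parametrized by the squared distance to the origin -/

/-- The parameter `τ r` is, for large `r`, the only large one at which the ray `η` meets the circle
of squared radius `r`, and it depends on `r` in a differentiable and increasing way. -/
structure IsRadialInverse (η : ℝ → Fin 2 → ℝ) (τ : ℝ → ℝ) : Prop where
  tendsto : Tendsto τ atTop atTop
  normSq : ∀ᶠ r in atTop, normSq₂ (η (τ r)) = r
  leftInv : ∀ᶠ t in atTop, τ (normSq₂ (η t)) = t
  deriv_pos : ∀ᶠ r in atTop, ∃ d, 0 < d ∧ HasDerivAt τ d r

theorem HasDerivAt.normSq₂ {z : ℝ → Fin 2 → ℝ} {v : Fin 2 → ℝ} {s : ℝ} (h : HasDerivAt z v s) :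
    HasDerivAt (fun s => normSq₂ (z s)) (2 * (z s 0 * v 0 + z s 1 * v 1)) s := by
  rw [hasDerivAt_pi] at h
  refine (((h 0).fun_pow 2).fun_add ((h 1).fun_pow 2)).congr_deriv ?_
  simp
  ring

theorem continuous_normSq₂ : Continuous normSq₂ := by unfold normSq₂; fun_prop

theorem Continuous.orient {X : Type*} [TopologicalSpace X] {f g k : X → Fin 2 → ℝ}
    (hf : Continuous f) (hg : Continuous g) (hk : Continuous k) :
    Continuous fun x => orient (f x) (g x) (k x) := by
  rw [continuous_pi_iff] at hf hg hk
  exact (((hg 0).sub (hf 0)).mul ((hk 1).sub (hf 1))).sub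
    (((hg 1).sub (hf 1)).mul ((hk 0).sub (hf 0)))

/-- Differentiating `normSq₂ (η (τ r)) = r` shows that the ray crosses large circles transversally
and outwards. -/
theorem IsRadialInverse.eventually_deriv {η : ℝ → Fin 2 → ℝ} {τ : ℝ → ℝ}
    (h : IsRadialInverse η τ) (hη : Differentiable ℝ η) :
    ∀ᶠ r in atTop, ∃ d, 0 < d ∧ HasDerivAt τ d r ∧
      2 * (η (τ r) 0 * deriv η (τ r) 0 + η (τ r) 1 * deriv η (τ r) 1) * d = 1 := by
  obtain ⟨M, hM⟩ := eventually_atTop.1 h.normSq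
  filter_upwards [h.deriv_pos, eventually_gt_atTop M] with r ⟨d, hd, hτ⟩ hr
  refine ⟨d, hd, hτ, ?_⟩
  have h1 : HasDerivAt (fun r => normSq₂ (η (τ r))) _ r :=
    HasDerivAt.comp (h₂ := fun t => normSq₂ (η t)) r ((hη (τ r)).hasDerivAt.normSq₂) hτ
  refine h1.unique ((hasDerivAt_id r).congr_of_eventuallyEq ?_)
  filter_upwards [lt_mem_nhds hr] with x hx using hM x hx.le

theorem det_mul_cross (L : (Fin 2 → ℝ) →L[ℝ] (Fin 2 → ℝ)) (u v : Fin 2 → ℝ) :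
    L u 0 * L v 1 - L u 1 * L v 0 = L.det * (u 0 * v 1 - u 1 * v 0) := by
  have hL : ∀ w i, L w i = w 0 * L (Pi.single 0 1) i + w 1 * L (Pi.single 1 1) i := by
    intro w i
    have : w = w 0 • Pi.single 0 1 + w 1 • Pi.single 1 1 := by
      ext j; fin_cases j <;> simp
    conv_lhs => rw [this]
    simp
  have hdet : L.det = L (Pi.single 0 1) 0 * L (Pi.single 1 1) 1 -
      L (Pi.single 1 1) 0 * L (Pi.single 0 1) 1 := by
    rw [ContinuousLinearMap.det, ← LinearMap.det_toMatrix', Matrix.det_fin_two]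
    simp [LinearMap.toMatrix'_apply]
  rw [hL u 0, hL v 1, hL u 1, hL v 0, hdet]
  ring

theorem HasDerivAt.eventually_pos_right {f : ℝ → ℝ} {d x : ℝ} (h : HasDerivAt f d x) (hd : 0 < d)
    (hx : f x = 0) : ∀ᶠ s in 𝓝[>] x, 0 < f s := by
  have h1 := (hasDerivAt_iff_tendsto_slope.1 h).eventually_const_lt hd
  have h2 : 𝓝[>] x ≤ 𝓝[≠] x := nhdsWithin_mono x fun y hy => ne_of_gt hy
  filter_upwards [h2 h1, self_mem_nhdsWithin] with s hs (hxs : x < s)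
  rw [slope_def_field, hx, sub_zero] at hs
  exact (div_pos_iff_of_pos_right (sub_pos.2 hxs)).1 hs

/-- A path that leaves a ray to its left enters the region that begins at this ray. -/
theorem eventually_orient_pos {η : ℝ → Fin 2 → ℝ} {τ : ℝ → ℝ} {Γ : ℝ → Fin 2 → ℝ}
    {z : ℝ → Fin 2 → ℝ} {e v w : Fin 2 → ℝ} {r d : ℝ} (hz : HasDerivAt z v 0)
    (hr : normSq₂ (z 0) = r) (hz0 : z 0 = η (τ r)) (hη : HasDerivAt η e (τ r))
    (hτ : HasDerivAt τ d r) (hd : 0 < d) (hed : 2 * (η (τ r) 0 * e 0 + η (τ r) 1 * e 1) * d = 1)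
    (hΓ : HasDerivAt Γ w r) (hΓr : normSq₂ (Γ r) = r) (hne : Γ r ≠ z 0)
    (hev : 0 < e 0 * v 1 - e 1 * v 0) :
    ∀ᶠ s in 𝓝[>] 0,
      0 < orient (η (τ (normSq₂ (z s)))) (z s) (Γ (normSq₂ (z s))) := by
  subst hr
  have hρ := hz.normSq₂
  have hA : HasDerivAt (fun s => η (τ (normSq₂ (z s)))) _ 0 :=
    HasDerivAt.scomp (g₁ := fun r => η (τ r)) (0 : ℝ) (HasDerivAt.scomp (g₁ := η) _ hη hτ) hρ
  have hB : HasDerivAt (fun s => Γ (normSq₂ (z s))) _ 0 :=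
    HasDerivAt.scomp (g₁ := Γ) (0 : ℝ) hΓ hρ
  rw [hasDerivAt_pi] at hA hB hz
  have hS := (((hz 0).fun_sub (hA 0)).fun_mul ((hB 1).fun_sub (hA 1))).fun_sub
    (((hz 1).fun_sub (hA 1)).fun_mul ((hB 0).fun_sub (hA 0)))
  refine hS.eventually_pos_right ?_ ?_
  · have hpos := sub_inner_pos rfl hΓr hne
    rw [← hz0] at hed ⊢
    -- As `z` starts on the ray, only the relative velocity v - 2d(z · v)e contributes. By `hed` it
    -- is tangent to the circle: it equals 2d(e × v) times `z` turned by a right angle. Its cross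
    -- product with b - z is 2d(e × v)(|z|² - z · b), which is positive.
    simp only [sub_self, zero_mul, add_zero, Pi.smul_apply, smul_eq_mul]
    generalize Γ (normSq₂ (z 0)) = b at *
    refine (mul_pos (mul_pos two_pos hd) (mul_pos hev hpos)).trans_eq ?_
    unfold normSq₂
    linear_combination (v 0 * (b 1 - z 0 1) - v 1 * (b 0 - z 0 0)) * hed
  · rw [← hz0]; ring

/-- Compactness of discs; applied to an inverse homeomorphism it gives properness. -/
theorem exists_forall_normSq₂_le {f : (Fin 2 → ℝ) → Fin 2 → ℝ} (hf : Continuous f) (M : ℝ) :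
    ∃ R, ∀ x, normSq₂ x ≤ M → normSq₂ (f x) < R := by
  have hK : IsCompact {x : Fin 2 → ℝ | normSq₂ x ≤ M} := by
    refine Metric.isCompact_of_isClosed_isBounded
      (isClosed_le continuous_normSq₂ continuous_const) ?_
    refine (Metric.isBounded_closedBall (x := 0) (r := M + 1)).subset ?_
    intro x hx
    rw [Set.mem_ofPred_eq, normSq₂] at hx
    have hM : 0 ≤ M + 1 := by nlinarith [sq_nonneg (x 0), sq_nonneg (x 1)]
    rw [mem_closedBall_zero_iff, pi_norm_le_iff_of_nonneg hM]
    intro i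
    rw [Real.norm_eq_abs, abs_le]
    fin_cases i
    · constructor <;> simp <;> nlinarith [sq_nonneg (x 0 - 1), sq_nonneg (x 0 + 1), sq_nonneg (x 1)]
    · constructor <;> simp <;> nlinarith [sq_nonneg (x 1 - 1), sq_nonneg (x 1 + 1), sq_nonneg (x 0)]
  obtain ⟨R, hR⟩ := (hK.image (continuous_normSq₂.comp hf)).bddAbove
  exact ⟨R + 1, fun x hx => (hR ⟨x, hx, rfl⟩).trans_lt (lt_add_one R)⟩

theorem exists_mem_Icc_eq_zero {f : ℝ → ℝ} {a b : ℝ} (hab : a ≤ b)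
    (hf : ContinuousOn f (Set.Icc a b)) (ha : 0 < f a) (hb : f b < 0) :
    ∃ x ∈ Set.Icc a b, f x = 0 := by
  obtain ⟨x, hx, h⟩ := intermediate_value_Icc' hab hf ⟨hb.le, ha.le⟩
  exact ⟨x, hx, h⟩

/-- A homeomorphism that preserves orientation preserves the circular order of rays. -/
theorem eventually_orient_pos_of_homeomorph (h : (Fin 2 → ℝ) ≃ₜ (Fin 2 → ℝ))
    (hd : Differentiable ℝ h) (hds : Differentiable ℝ h.symm)
    (hdet : ∀ x, 0 < (fderiv ℝ h x).det) {η : Fin 3 → ℝ → Fin 2 → ℝ} {τ τ' : Fin 3 → ℝ → ℝ}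
    (hη : ∀ i, Differentiable ℝ (η i)) (hτ : ∀ i, IsRadialInverse (η i) (τ i))
    (hτ' : ∀ i, IsRadialInverse (h ∘ η i) (τ' i))
    (H : ∀ᶠ r in atTop, 0 < orient (η 0 (τ 0 r)) (η 1 (τ 1 r)) (η 2 (τ 2 r))) :
    ∀ᶠ r in atTop, 0 < orient (h (η 0 (τ' 0 r))) (h (η 1 (τ' 1 r))) (h (η 2 (τ' 2 r))) := by
  have hη' : ∀ i, Differentiable ℝ (h ∘ η i) := fun i => hd.comp (hη i)
  obtain ⟨T, hT⟩ := eventually_atTop.1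
    ((eventually_all.2 fun i => (hτ i).leftInv).and (eventually_all.2 fun i => (hτ' i).leftInv))
  obtain ⟨M, hM⟩ := eventually_atTop.1 <|
    (H.and (eventually_all.2 fun i => (hτ i).normSq)).and <|
    (eventually_all.2 fun i => (hτ i).eventually_deriv (hη i)).and
    (eventually_all.2 fun i => (hτ i).tendsto.eventually_ge_atTop T)
  obtain ⟨R₀, hR₀⟩ := exists_forall_normSq₂_le h.continuous M
  have hlarge : ∀ y, R₀ ≤ normSq₂ y → M ≤ normSq₂ (h.symm y) := by
    intro y hy
    by_contra hlt
    have := hR₀ (h.symm y) (not_le.1 hlt).le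
    rw [h.apply_symm_apply] at this
    exact this.not_ge hy
  filter_upwards [eventually_ge_atTop R₀, eventually_gt_atTop 0,
    eventually_all.2 fun i => (hτ' i).normSq,
    (hτ' 0).eventually_deriv (hη' 0),
    eventually_all.2 fun i => (hτ' i).tendsto.eventually_ge_atTop T]
    with R hRR₀ hR0 hnorm ⟨d', hd', hτd', hed'⟩ hRT
  simp only [Function.comp_apply] at hnorm hed'
  -- points of the image rays on the circle are images of points of the rays
  have hmeet : ∀ i y, normSq₂ y = R →
      (h.symm y = η i (τ i (normSq₂ (h.symm y))) ↔ y = h (η i (τ' i R))) := by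
    intro i y hy
    constructor
    · intro e
      have hy' : y = h (η i (τ i (normSq₂ (h.symm y)))) := by rw [← e, h.apply_symm_apply]
      have h1 := (hT _ ((hM _ (hlarge y (hRR₀.trans_eq hy.symm))).2.2 i)).2 i
      rw [Function.comp_apply, ← hy', hy] at h1
      rw [h1, ← hy']
    · rintro rfl
      rw [h.symm_apply_apply, (hT _ (hRT i)).1 i]
  set A := h (η 0 (τ' 0 R)) with hA
  set B := h (η 1 (τ' 1 R)) with hB
  set C := h (η 2 (τ' 2 R)) with hC
  have hnA : normSq₂ A = R := hnorm 0
  have hnB : normSq₂ B = R := hnorm 1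
  have hnC : normSq₂ C = R := hnorm 2
  have hMA := hM _ (hlarge A (hRR₀.trans_eq hnA.symm))
  have hMB := hM _ (hlarge B (hRR₀.trans_eq hnB.symm))
  have hMC := hM _ (hlarge C (hRR₀.trans_eq hnC.symm))
  have hAB : A ≠ B := by
    intro e
    have h1 := hMA.1.1
    rw [← (hmeet 0 A hnA).2 rfl, ← (hmeet 1 A hnA).2 e, orient_self_left] at h1
    exact h1.false
  have hAC : A ≠ C := by
    intro e
    have h1 := hMA.1.1
    rw [← (hmeet 0 A hnA).2 rfl, ← (hmeet 2 A hnA).2 e, orient_self_outer] at h1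
    exact h1.false
  have hBC : B ≠ C := by
    intro e
    have h1 := hMB.1.1
    rw [← (hmeet 1 B hnB).2 rfl, ← (hmeet 2 B hnB).2 e, orient_self_right] at h1
    exact h1.false
  -- If the order were A, C, B, walk counterclockwise along the circle from A to C, not passing B,
  -- and pull the walk back by `h` to a path `z`. Let `S` be the orientation of ray 0, `z`, ray 1 on
  -- the circle through `z`. It is positive just after the start, negative at C, which lies on ray
  -- 2, and nonzero in between since `z` avoids rays 0 and 1: a contradiction.
  by_contra hcon
  have hneg : 0 < orient A C B := by
    rw [orient_swap_right, neg_pos]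
    exact (not_lt.1 hcon).lt_of_ne (orient_ne_zero hnA hnB hnC hAB hBC hAC)
  obtain ⟨b, hb0, hbpi, hbB⟩ := exists_rotate₂_eq hR0 hnA hnB
  obtain ⟨c, hc0, hcpi, hcC⟩ := exists_rotate₂_eq hR0 hnA hnC
  rw [← hbB, ← hcC] at hneg
  obtain ⟨hcpos, hcb⟩ := lt_of_orient_rotate₂_pos hc0 hcpi hb0 hbpi hneg
  have hnr : ∀ s, normSq₂ (rotate₂ A s) = R := fun s => (normSq₂_rotate₂ A s).trans hnA
  set z : ℝ → Fin 2 → ℝ := fun s => h.symm (rotate₂ A s) with hz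
  have hMz : ∀ s, _ := fun s => hM _ (hlarge (rotate₂ A s) (hRR₀.trans_eq (hnr s).symm))
  have hΓ : ∀ i s, ∃ w, HasDerivAt (fun r => η i (τ i r)) w (normSq₂ (z s)) := fun i s => by
    obtain ⟨d, -, h1, -⟩ := (hMz s).2.1 i
    exact ⟨_, HasDerivAt.scomp (g₁ := η i) _ (hη i _).hasDerivAt h1⟩
  have hzc : Continuous z := h.symm.continuous.comp (continuous_rotate₂ A)
  set S : ℝ → ℝ := fun s => orient (η 0 (τ 0 (normSq₂ (z s)))) (z s) (η 1 (τ 1 (normSq₂ (z s))))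
    with hSdef
  have hScont : Continuous S := by
    have hc : ∀ i, Continuous fun s => η i (τ i (normSq₂ (z s))) := fun i => by
      rw [continuous_iff_continuousAt]
      intro s
      obtain ⟨w, hw⟩ := hΓ i s
      exact ContinuousAt.comp (g := fun r => η i (τ i r)) hw.continuousAt
        (continuous_normSq₂.comp hzc).continuousAt
    exact (hc 0).orient hzc (hc 1)
  have hSne : ∀ s, 0 < s → s ≤ c → S s ≠ 0 := by
    intro s hs hsc
    refine orient_ne_zero (r := normSq₂ (z s)) ((hMz s).1.2 0) rfl ((hMz s).1.2 1) ?_ ?_ ?_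
    · intro e
      have := (hmeet 0 _ (hnr s)).1 e.symm
      exact rotate₂_ne_self (by rwa [hnA]) hs (by linarith) this
    · intro e
      have := (hmeet 1 _ (hnr s)).1 e
      rw [← hB, ← hbB] at this
      exact rotate₂_ne_rotate₂ (by rwa [hnA]) hs.le (by linarith) hbpi this
    · intro e
      have h1 := (hMz s).1.1
      change 0 < orient (η 0 (τ 0 (normSq₂ (z s)))) (η 1 (τ 1 (normSq₂ (z s)))) _ at h1
      rw [e, orient_self_left] at h1
      exact h1.false
  have hSc : S c < 0 := by
    have h1 : z c = η 2 (τ 2 (normSq₂ (z c))) := (hmeet 2 _ (hnr c)).2 hcC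
    have h2 := (hMz c).1.1
    change 0 < orient (η 0 (τ 0 (normSq₂ (z c)))) (η 1 (τ 1 (normSq₂ (z c))))
      (η 2 (τ 2 (normSq₂ (z c)))) at h2
    rw [← h1, orient_swap_right] at h2
    exact neg_pos.1 h2
  -- the initial velocity of `z` points to the left of the first ray
  have hz0 : z 0 = η 0 (τ 0 (normSq₂ (z 0))) :=
    (hmeet 0 _ (hnr 0)).2 (rotate₂_zero A)
  have hz0' : z 0 = η 0 (τ' 0 R) := by
    simp only [hz, rotate₂_zero, hA, h.symm_apply_apply]
  have ht : τ 0 (normSq₂ (z 0)) = τ' 0 R := by rw [hz0', (hT _ (hRT 0)).1 0]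
  obtain ⟨d, hdpos, hτd, hed⟩ := (hMz 0).2.1 0
  change HasDerivAt (τ 0) d (normSq₂ (z 0)) at hτd
  obtain ⟨w, hw⟩ := hΓ 1 0
  have hzd : HasDerivAt z (deriv z 0) 0 := by
    refine DifferentiableAt.hasDerivAt ?_
    exact (hds _).comp _ (hasDerivAt_rotate₂ A).differentiableAt
  -- The differential of `h` sends the velocity of `z` to the counterclockwise tangent at A, which
  -- lies to the left of the outgoing image ray; the positive determinant carries this back through
  -- `h`.
  have hev : 0 < deriv (η 0) (τ 0 (normSq₂ (z 0))) 0 * deriv z 0 1 -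
      deriv (η 0) (τ 0 (normSq₂ (z 0))) 1 * deriv z 0 0 := by
    have h1 : fderiv ℝ h (z 0) (deriv z 0) = ![-A 1, A 0] := by
      have h2 : HasDerivAt (h ∘ z) _ 0 := (hd (z 0)).hasFDerivAt.comp_hasDerivAt _ hzd
      have h3 : h ∘ z = rotate₂ A := funext fun s => h.apply_symm_apply _
      rw [h3] at h2
      exact h2.unique (hasDerivAt_rotate₂ A)
    have h2 : deriv (h ∘ η 0) (τ' 0 R) = fderiv ℝ h (z 0) (deriv (η 0) (τ' 0 R)) := by
      rw [hz0']
      exact ((hd _).hasFDerivAt.comp_hasDerivAt _ (hη 0 _).hasDerivAt).deriv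
    have h3 := det_mul_cross (fderiv ℝ h (z 0)) (deriv (η 0) (τ' 0 R)) (deriv z 0)
    rw [h1, ← h2] at h3
    rw [ht]
    refine (pos_iff_pos_of_mul_pos (a := (fderiv ℝ h (z 0)).det) ?_).1 (hdet _)
    rw [← h3]
    simp only [Matrix.cons_val_zero, Matrix.cons_val_one]
    nlinarith
  have hstart := eventually_orient_pos (Γ := fun r => η 1 (τ 1 r)) hzd rfl hz0
    (hη 0 _).hasDerivAt hτd hdpos hed hw ((hMz 0).1.2 1) ?_ hev
  · obtain ⟨s, hs, hspos, hsc⟩ := (hstart.and (Ioc_mem_nhdsGT hcpos)).exists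
    obtain ⟨x, hx, hx0⟩ := exists_mem_Icc_eq_zero hsc hScont.continuousOn hs hSc
    exact hSne x (hspos.trans_le hx.1) hx.2 hx0
  · intro e
    have h1 := (hMz 0).1.1
    change 0 < orient (η 0 (τ 0 (normSq₂ (z 0)))) (η 1 (τ 1 (normSq₂ (z 0)))) _ at h1
    rw [← hz0, e, orient_self_left] at h1
    exact h1.false

/-! ### Polynomial images of lines -/

/-- The line with slope `k.1` and intercept `k.2`, parametrized by the first coordinate. -/
def line (k : ℝ × ℝ) (t : ℝ) : Fin 2 → ℝ := ![0, k.2] + t • ![1, k.1]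

theorem line_zero (k : ℝ × ℝ) (t : ℝ) : line k t 0 = t := by simp [line]

theorem line_one (k : ℝ × ℝ) (t : ℝ) : line k t 1 = k.1 * t + k.2 := by
  simp [line]; ring

theorem IsPolynomialMap.exists_polynomial {f : (Fin 2 → ℝ) → Fin 2 → ℝ} (hf : IsPolynomialMap f)
    (a b : Fin 2 → ℝ) (i : Fin 2) : ∃ q : ℝ[X], ∀ s, q.eval s = f (a + s • b) i := by
  obtain ⟨P, hP⟩ := hf
  simp only [hP]
  induction P i using MvPolynomial.induction_on with
  | C c => exact ⟨C c, fun s => by simp⟩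
  | add p q hp hq =>
    obtain ⟨p', hp⟩ := hp
    obtain ⟨q', hq⟩ := hq
    exact ⟨p' + q', fun s => by simp [hp, hq]⟩
  | mul_X p j hp =>
    obtain ⟨p', hp⟩ := hp
    refine ⟨p' * (C (a j) + X * C (b j)), fun s => by simp [hp, mul_comm s]⟩

theorem Polynomial.eventually_eval_ne_zero {q : ℝ[X]} (hq : q ≠ 0) :
    ∀ᶠ x in atTop, q.eval x ≠ 0 := by
  obtain ⟨B, hB⟩ := (finite_setOfPred_isRoot hq).bddAbove
  filter_upwards [eventually_gt_atTop B] with x hx h0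
  exact (hB h0).not_gt hx

theorem Polynomial.eventually_derivative_pos {q : ℝ[X]}
    (hq : Tendsto (fun t => q.eval t) atTop atTop) : ∀ᶠ t in atTop, 0 < q.derivative.eval t := by
  obtain ⟨hdeg, hlc⟩ := (tendsto_atTop_iff_leadingCoeff_nonneg q).1 hq
  have hnat : 0 < q.natDegree := natDegree_pos_iff_degree_pos.2 hdeg
  have hlc' : 0 < q.leadingCoeff :=
    hlc.lt_of_ne (leadingCoeff_ne_zero.2 (ne_zero_of_degree_gt hdeg)).symm
  have hpos : 0 < q.derivative.leadingCoeff := by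
    rw [leadingCoeff_derivative]
    positivity
  rcases lt_or_ge 0 q.derivative.degree with h | h
  · exact (tendsto_atTop_of_leadingCoeff_nonneg _ h hpos.le).eventually_gt_atTop 0
  · rw [eq_C_of_degree_le_zero h] at hpos ⊢
    rw [leadingCoeff_C] at hpos
    exact Eventually.of_forall fun t => by rwa [eval_C]

theorem exists_isRadialInverse {η : ℝ → Fin 2 → ℝ} {N : ℝ[X]}
    (hN : ∀ t, N.eval t = normSq₂ (η t)) (hlim : Tendsto (fun t => N.eval t) atTop atTop) :
    ∃ τ, IsRadialInverse η τ := by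
  obtain ⟨T, hT⟩ := eventually_atTop.1 (eventually_derivative_pos hlim)
  have hmono : StrictMonoOn (fun t => N.eval t) (Set.Ici T) := by
    refine strictMonoOn_of_deriv_pos (convex_Ici T) N.continuous.continuousOn fun x hx => ?_
    rw [interior_Ici] at hx
    rw [Polynomial.deriv]
    exact hT x (le_of_lt hx)
  have hex : ∀ r, N.eval T ≤ r → ∃ t, T ≤ t ∧ N.eval t = r := by
    intro r hr
    obtain ⟨u, hu, hTu⟩ := ((hlim.eventually_ge_atTop r).and (eventually_ge_atTop T)).exists
    obtain ⟨t, ht, h⟩ := intermediate_value_Icc hTu N.continuous.continuousOn ⟨hr, hu⟩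
    exact ⟨t, ht.1, h⟩
  choose! τ hτT hτ using hex
  have hleft : ∀ t, T ≤ t → τ (N.eval t) = t := fun t ht => by
    have h := hmono.monotoneOn Set.self_mem_Ici ht ht
    exact hmono.injOn (hτT _ h) ht (hτ _ h)
  refine ⟨τ, ?_, ?_, ?_, ?_⟩
  · refine tendsto_atTop.2 fun u => ?_
    filter_upwards [eventually_ge_atTop (N.eval (max u T))] with r hr
    have h0 : N.eval T ≤ N.eval (max u T) :=
      hmono.monotoneOn Set.self_mem_Ici (le_max_right u T) (le_max_right u T)
    refine (le_max_left u T).trans ((hmono.le_iff_le (le_max_right u T) (hτT r (h0.trans hr))).1 ?_)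
    simpa only [hτ r (h0.trans hr)] using hr
  · filter_upwards [eventually_ge_atTop (N.eval T)] with r hr
    rw [← hN, hτ r hr]
  · filter_upwards [eventually_ge_atTop T] with t ht
    rw [← hN, hleft t ht]
  · filter_upwards [eventually_gt_atTop (N.eval T)] with r hr
    have hTt : T < τ r := by
      refine (hτT r hr.le).lt_of_ne fun h => ?_
      have e := hτ r hr.le
      rw [← h] at e
      exact hr.ne e
    have hd := hT _ hTt.le
    have hs := N.hasStrictDerivAt (τ r)
    refine ⟨(N.derivative.eval (τ r))⁻¹, inv_pos.2 hd, ?_⟩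
    -- Near `r` the local inverse takes values above `T`, where `τ` inverts the polynomial, so it
    -- agrees with `τ`.
    have hg := (hs.to_localInverse hd.ne').hasDerivAt
    have himg : hs.localInverse _ _ _ hd.ne' (N.eval (τ r)) = τ r :=
      HasStrictFDerivAt.localInverse_apply_image ..
    have hright := hs.eventually_right_inverse hd.ne'
    have hlarge := hg.continuousAt.eventually (by rw [himg]; exact lt_mem_nhds hTt)
    rw [hτ r hr.le] at hg hright hlarge
    refine hg.congr_of_eventuallyEq ?_
    filter_upwards [hright, hlarge] with x hx hTx
    conv_lhs => rw [← hx]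
    exact hleft _ (le_of_lt hTx)

theorem exists_isRadialInverse_line (g : (Fin 2 → ℝ) ≃ₜ (Fin 2 → ℝ)) (hg : IsPolynomialMap g)
    (k : ℝ × ℝ) : ∃ τ, IsRadialInverse (g ∘ line k) τ := by
  obtain ⟨q₀, h₀⟩ := hg.exists_polynomial ![0, k.2] ![1, k.1] 0
  obtain ⟨q₁, h₁⟩ := hg.exists_polynomial ![0, k.2] ![1, k.1] 1
  have hN : ∀ t, (q₀ ^ 2 + q₁ ^ 2).eval t = normSq₂ ((g ∘ line k) t) := fun t => by
    simp [h₀, h₁, normSq₂, line]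
  refine exists_isRadialInverse hN (tendsto_atTop.2 fun M => ?_)
  obtain ⟨R, hR⟩ := exists_forall_normSq₂_le g.symm.continuous M
  -- The point of the line at parameter `t` has squared norm at least t².
  filter_upwards [(tendsto_pow_atTop two_ne_zero).eventually_ge_atTop R] with t ht
  rw [hN]
  by_contra hlt
  have h := hR _ (not_le.1 hlt).le
  rw [Function.comp_apply, g.symm_apply_apply, normSq₂, line_zero] at h
  nlinarith [sq_nonneg (line k t 1)]

/-- A polynomial map that maps many lines to themselves is the identity. -/
theorem IsPolynomialMap.eq_id_of_frequently {f : (Fin 2 → ℝ) → Fin 2 → ℝ} (hf : IsPolynomialMap f)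
    (h : ∃ᶠ k in (atTop : Filter ℝ).curry (atTop : Filter ℝ),
      ∀ t, f (line k t) 1 = k.1 * f (line k t) 0 + k.2) : f = _root_.id := by
  rw [frequently_curry_iff] at h
  have key : ∃ᶠ m in (atTop : Filter ℝ), ∀ x, f x 1 - x 1 = m * (f x 0 - x 0) := by
    refine h.mono fun m hm x => ?_
    obtain ⟨q₀, h₀⟩ := hf.exists_polynomial ![x 0, m * x 0] ![0, 1] 0
    obtain ⟨q₁, h₁⟩ := hf.exists_polynomial ![x 0, m * x 0] ![0, 1] 1
    have hline : ∀ s, ![x 0, m * x 0] + s • ![0, 1] = line (m, s) (x 0) := fun s => by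
      ext i
      fin_cases i
      · simp [line_zero]
      · simp [line_one]
    -- With slope `m` and abscissa `x 0` fixed, the condition is polynomial in the intercept and has
    -- arbitrarily large zeros, so it holds for all intercepts. Two slopes then determine the
    -- displacement to be zero.
    have hq : q₁ - C m * q₀ - X = 0 := by
      by_contra hne
      refine hm ((eventually_eval_ne_zero hne).mono fun s hs hall => hs ?_)
      have hx := hall (x 0)
      simp only at hx
      simp only [eval_sub, eval_mul, eval_C, eval_X, h₀, h₁, hline, hx]
      ring
    have hx : ![x 0, m * x 0] + (x 1 - m * x 0) • ![0, 1] = x := by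
      ext i; fin_cases i <;> simp
    have := congrArg (eval (x 1 - m * x 0)) hq
    simp only [eval_sub, eval_mul, eval_C, eval_X, eval_zero, h₀, h₁, hx] at this
    linarith
  obtain ⟨m, hm⟩ := key.exists
  obtain ⟨n, hn, hmn⟩ := (key.and_eventually (eventually_gt_atTop m)).exists
  funext x
  have h0 : f x 0 - x 0 = 0 := by
    have : (n - m) * (f x 0 - x 0) = 0 := by linarith [hm x, hn x]
    exact (mul_eq_zero.1 this).resolve_left (sub_pos.2 hmn).ne'
  have h1 : f x 1 - x 1 = 0 := by rw [hm x, h0, mul_zero]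
  ext i
  fin_cases i
  · exact sub_eq_zero.1 h0
  · exact sub_eq_zero.1 h1

/-- The equation of the line, pulled back along the image curve, is a nonzero polynomial in `t`,
with finitely many roots. -/
theorem IsPolynomialMap.eventually_line_ne {f : (Fin 2 → ℝ) → Fin 2 → ℝ} (hf : IsPolynomialMap f)
    {k : ℝ × ℝ} (h : ¬∀ t, f (line k t) 1 = k.1 * f (line k t) 0 + k.2) :
    ∀ᶠ t in atTop, ∀ u, f (line k t) ≠ line k u := by
  obtain ⟨q₀, h₀⟩ := hf.exists_polynomial ![0, k.2] ![1, k.1] 0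
  obtain ⟨q₁, h₁⟩ := hf.exists_polynomial ![0, k.2] ![1, k.1] 1
  have heval : ∀ t, (q₁ - C k.1 * q₀ - C k.2).eval t =
      f (line k t) 1 - k.1 * f (line k t) 0 - k.2 := fun t => by simp [h₀, h₁, line]
  have hne : q₁ - C k.1 * q₀ - C k.2 ≠ 0 := fun h0 => h fun t => by
    have := heval t
    rw [h0, eval_zero] at this
    linarith
  filter_upwards [eventually_eval_ne_zero hne] with t ht u hu
  rw [heval, hu, line_zero, line_one] at ht
  exact ht (by ring)

/-! ### The circular order -/

/-- The weak relation is the negation of the reversed strict one, so it holds whenever two of the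
three points coincide. -/
theorem circularlyOrderable_of_pos {G : Type*} [Group G] (pos : G → G → G → Prop)
    (cyclic : ∀ a b c, pos a b c → pos b c a) (asymm : ∀ a b c, pos a b c → ¬pos c b a)
    (trans : ∀ a b c d, pos a b c → pos b d c → pos a d c)
    (total : ∀ a b c, a ≠ b → b ≠ c → c ≠ a → pos a b c ∨ pos c b a)
    (mul_left : ∀ g a b c, pos a b c → pos (g * a) (g * b) (g * c)) : CircularlyOrderable G := by
  refine ⟨{ btw := fun a b c => ¬pos c b a
            sbtw := pos
            btw_refl := fun a h => asymm a a a h h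
            btw_cyclic_left := fun h h' => h (cyclic _ _ _ h')
            sbtw_iff_btw_not_btw :=
              ⟨fun h => ⟨asymm _ _ _ h, not_not.2 h⟩, fun h => not_not.1 h.2⟩
            sbtw_trans_left := trans _ _ _ _
            btw_antisymm := ?_
            btw_total := ?_ }, ?_⟩
  · intro a b c h h'
    by_contra! hne
    exact (total a b c hne.1 hne.2.1 hne.2.2).elim h' h
  · intro a b c
    by_contra! h
    exact asymm _ _ _ h.1 h.2
  · intro g x y z h h'
    have := mul_left g⁻¹ _ _ _ h'
    simp only [inv_mul_cancel_left] at this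
    exact h this

namespace PolyPlus

theorem isPolynomialMap (g : PolyPlus) : IsPolynomialMap g.1 := g.2.1

/-- For large `r`, the parameter at which the image of the line `k` under `g` meets the circle of
squared radius `r`. -/
noncomputable def radius (g : PolyPlus) (k : ℝ × ℝ) : ℝ → ℝ :=
  (exists_isRadialInverse_line g.1 (isPolynomialMap g) k).choose

theorem isRadialInverse_radius (g : PolyPlus) (k : ℝ × ℝ) :
    IsRadialInverse (g.1 ∘ line k) (radius g k) :=
  (exists_isRadialInverse_line g.1 (isPolynomialMap g) k).choose_spec

/-- For large `r`, the point where the ray of the image of the line `k` under `g` meets the circle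
of squared radius `r`. -/
noncomputable def rayPoint (g : PolyPlus) (k : ℝ × ℝ) (r : ℝ) : Fin 2 → ℝ :=
  g.1 (line k (radius g k r))

instance neBot_curry_atTop : ((atTop : Filter ℝ).curry (atTop : Filter ℝ)).NeBot := by
  refine ⟨fun h => ?_⟩
  have h1 : ∀ᶠ _k in (atTop : Filter ℝ).curry (atTop : Filter ℝ), False := by
    rw [h]
    exact eventually_bot
  rw [eventually_curry_iff] at h1
  exact h1.exists.elim fun _ h2 => h2.exists.elim fun _ h3 => h3

/-- An ultrafilter of lines that contains every eventual property of slope and intercept. -/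
noncomputable def lines : Ultrafilter (ℝ × ℝ) :=
  Ultrafilter.of ((atTop : Filter ℝ).curry (atTop : Filter ℝ))

/-- The images of almost every line under `a`, `b` and `c` are positively ordered at infinity. -/
def Pos (a b c : PolyPlus) : Prop :=
  ∀ᶠ k in (lines : Filter (ℝ × ℝ)), ∀ᶠ r in atTop,
    0 < orient (rayPoint a k r) (rayPoint b k r) (rayPoint c k r)

theorem differentiable_line (g : PolyPlus) (k : ℝ × ℝ) : Differentiable ℝ (g.1 ∘ line k) :=
  (isPolynomialMap g).differentiable.comp (by unfold line; fun_prop)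

theorem eventually_normSq₂_rayPoint (g : PolyPlus) (k : ℝ × ℝ) :
    ∀ᶠ r in atTop, normSq₂ (rayPoint g k r) = r :=
  (isRadialInverse_radius g k).normSq

theorem eventually_continuousAt_rayPoint (g : PolyPlus) (k : ℝ × ℝ) :
    ∀ᶠ r in atTop, ContinuousAt (rayPoint g k) r := by
  filter_upwards [(isRadialInverse_radius g k).deriv_pos] with r ⟨d, _, hd⟩
  exact ContinuousAt.comp (g := g.1 ∘ line k) (differentiable_line g k).continuous.continuousAt
    hd.continuousAt

/-- A common point of the two rays would put a point of the image of the line under `a⁻¹ * b` back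
on the line. -/
theorem eventually_rayPoint_ne {a b : PolyPlus} (h : a ≠ b) :
    ∀ᶠ k in (lines : Filter (ℝ × ℝ)), ∀ᶠ r in atTop, rayPoint a k r ≠ rayPoint b k r := by
  refine Ultrafilter.of_le _ ?_
  have hf := isPolynomialMap (a⁻¹ * b)
  have hne : ¬∃ᶠ k in (atTop : Filter ℝ).curry (atTop : Filter ℝ), ∀ t,
      (a⁻¹ * b).1 (line k t) 1 = k.1 * (a⁻¹ * b).1 (line k t) 0 + k.2 := fun hk => by
    have h1 := hf.eq_id_of_frequently hk
    apply h
    rw [← inv_mul_eq_one]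
    exact Subtype.ext (Homeomorph.ext fun x => congrFun h1 x)
  filter_upwards [not_frequently.1 hne] with k hk
  filter_upwards [(isRadialInverse_radius b k).tendsto.eventually (hf.eventually_line_ne hk)]
    with r hr e
  refine hr (radius a k r) ?_
  change a.1.symm (rayPoint b k r) = _
  rw [← e]
  exact a.1.symm_apply_apply _

/-- Left multiplication moves the image curves but not the source lines, so the same set of lines
serves and no invariance of the ultrafilter is needed. -/
theorem Pos.mul_left {a b c : PolyPlus} (h : Pos a b c) (g : PolyPlus) :
    Pos (g * a) (g * b) (g * c) := by
  filter_upwards [h] with k hk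
  refine eventually_orient_pos_of_homeomorph g.1 (isPolynomialMap g).differentiable
    g.2.2.1.differentiable g.2.2.2.2 (η := ![a.1 ∘ line k, b.1 ∘ line k, c.1 ∘ line k])
    (τ := ![radius a k, radius b k, radius c k])
    (τ' := ![radius (g * a) k, radius (g * b) k, radius (g * c) k]) ?_ ?_ ?_ hk
  · intro i
    fin_cases i
    exacts [differentiable_line a k, differentiable_line b k, differentiable_line c k]
  · intro i
    fin_cases i
    exacts [isRadialInverse_radius a k, isRadialInverse_radius b k, isRadialInverse_radius c k]
  · intro i
    fin_cases i
    exacts [isRadialInverse_radius (g * a) k, isRadialInverse_radius (g * b) k,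
      isRadialInverse_radius (g * c) k]

theorem Pos.trans {a b c d : PolyPlus} (h₁ : Pos a b c) (h₂ : Pos b d c) : Pos a d c := by
  filter_upwards [h₁, h₂] with k hk₁ hk₂
  filter_upwards [hk₁, hk₂, eventually_normSq₂_rayPoint a k, eventually_normSq₂_rayPoint b k,
    eventually_normSq₂_rayPoint c k, eventually_normSq₂_rayPoint d k] with r h₁ h₂ ha hb hc hd
  exact orient_trans ha hb hc hd h₁ h₂

theorem pos_or_pos {a b c : PolyPlus} (hab : a ≠ b) (hbc : b ≠ c) (hca : c ≠ a) :
    Pos a b c ∨ Pos c b a := by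
  unfold Pos
  -- The ultrafilter decides: it suffices that almost every single line gives one of the two orders.
  -- For such a line the orientation is continuous and nonzero for large `r`, hence of constant
  -- sign.
  rw [← Ultrafilter.eventually_or]
  filter_upwards [eventually_rayPoint_ne hab, eventually_rayPoint_ne hbc,
    eventually_rayPoint_ne hca] with k h₁ h₂ h₃
  obtain ⟨M, hM⟩ := eventually_atTop.1 <| (h₁.and (h₂.and h₃)).and <|
    ((eventually_normSq₂_rayPoint a k).and
      ((eventually_normSq₂_rayPoint b k).and (eventually_normSq₂_rayPoint c k))).and <|
    (eventually_continuousAt_rayPoint a k).and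
      ((eventually_continuousAt_rayPoint b k).and (eventually_continuousAt_rayPoint c k))
  have hne : ∀ r ≥ M, orient (rayPoint a k r) (rayPoint b k r) (rayPoint c k r) ≠ 0 :=
    fun r hr => by
      obtain ⟨⟨h₁, h₂, h₃⟩, ⟨ha, hb, hc⟩, -⟩ := hM r hr
      exact orient_ne_zero ha hb hc h₁ h₂ h₃.symm
  have hcont : ContinuousOn
      (fun r => orient (rayPoint a k r) (rayPoint b k r) (rayPoint c k r)) (Set.Ici M) := by
    have hc : ∀ g : PolyPlus, (∀ r ≥ M, ContinuousAt (rayPoint g k) r) →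
        Continuous ((Set.Ici M).domRestrict (rayPoint g k)) := fun g hg =>
      continuousOn_iff_continuous_domRestrict.1 fun r hr => (hg r hr).continuousWithinAt
    rw [continuousOn_iff_continuous_domRestrict]
    exact (hc a fun r hr => (hM r hr).2.2.1).orient (hc b fun r hr => (hM r hr).2.2.2.1)
      (hc c fun r hr => (hM r hr).2.2.2.2)
  rcases lt_or_gt_of_ne (hne M le_rfl) with hneg | hpos
  · right
    filter_upwards [eventually_ge_atTop M] with r hr
    rw [orient_swap, neg_pos]
    by_contra hcon
    obtain ⟨x, hx, h0⟩ := intermediate_value_Icc hr (hcont.mono Set.Icc_subset_Ici_self)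
      ⟨hneg.le, not_lt.1 hcon⟩
    exact hne x hx.1 h0
  · left
    filter_upwards [eventually_ge_atTop M] with r hr
    by_contra hcon
    obtain ⟨x, hx, h0⟩ := intermediate_value_Icc' hr (hcont.mono Set.Icc_subset_Ici_self)
      ⟨not_lt.1 hcon, hpos.le⟩
    exact hne x hx.1 h0

end PolyPlus

theorem mainTheorem8 : CircularlyOrderable PolyPlus := by
  refine circularlyOrderable_of_pos PolyPlus.Pos (fun a b c h => ?_) (fun a b c h h' => ?_)
    (fun a b c d => PolyPlus.Pos.trans) (fun a b c => PolyPlus.pos_or_pos)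
    (fun g a b c h => h.mul_left g)
  · filter_upwards [h] with k hk
    filter_upwards [hk] with r hr
    rwa [orient_cyclic]
  · obtain ⟨k, hk, hk'⟩ := (h.and h').exists
    obtain ⟨r, hr, hr'⟩ := (hk.and hk').exists
    rw [orient_swap] at hr'
    linarith
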